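/- Conventions. A partially ordered group (po-group) is a group $G$ with a partial order such that $a\le b$ implies $sat\le sbt$ for all $a,b,s,t\in G$; its positive cone is $G^+=\{a\in G: a\ge e\}$. An $\ell$-group is a po-group whose order is a lattice order; an $\ell$-homomorphism is a group homomorphism that is also a lattice homomorphism. An $\ell$-group is representable if it is a subdirect product of totally ordered groups, and Abelian if its group is Abelian. A right pre-order on a po-group $G$ is identified with its cone: a proper submonoid $C\subsetneq G$ with $G=C\cup C^{-1}$ and $G^+\subseteq C$; it encodes the relation $a\preceq_C b\iff ba^{-1}\in C$. Let $\Omega_C$ be the chain obtained as the quotient of $G$ by the equivalence relation "$a\preceq_C b$ and $b\preceq_C a$", and let $\mathrm{Aut}(\Omega_C)$ be the $\ell$-group of its order-preserving bijections, with $f\cdot g$ standing for "$g$ after $f$" and pointwise lattice operations. Let $H_C$ be the $\ell$-subgroup of $\mathrm{Aut}(\Omega_C)$ generated by the maps $[b]\mapsto[ba]$, $a\in G$. For a variety $\mathsf V$ of $\ell$-groups, let $\mathcal P_{\mathsf V}(G)$ be the set of right pre-orders $C$ on $G$ with $H_C\in\mathsf V$, with the smallest topology containing all the sets $\{C : a\in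 C,\ a^{-1}\notin C\}$, $a\in G$. The minimal layer of $\mathcal P_{\mathsf V}(G)$ is the subspace of its inclusion-minimal elements. A right order on $G$ is a right pre-order $C$ with $C\cap C^{-1}=\{e\}$; an order on $G$ is a right order that is closed under conjugation. The sets of right orders and of orders on $G$ carry the subspace topology from the space of all right pre-orders on $G$ (equivalently, the topology with subbase the sets $\{C: a\in C\}$ and $\{C: a\notin C\}$, $a\in G$). Let $\eta\colon G\to F_{\mathsf V}(G)$ be the universal order-preserving homomorphism from $G$ to an $\ell$-group in $\mathsf V$: every order-preserving homomorphism $p\colon G\to H$ with $H\in\mathsf V$ factors as $p=h\circ\eta$ for exactly one $\ell$-homomorphism $h\colon F_{\mathsf V}(G)\to H$. Let $\eta[G]$ be the image of $G$, partially ordered by the restriction of the order of $F_{\mathsf V}(G)$. Theorem. Let $G$ be any partially ordered group. (1) If $\mathsf V$ is the variety of all $\ell$-groups, the minimal layer of $\mathcal P_{\mathsf V}(G)$ is homeomorphic to the space of right orders on $\eta[G]$. (2) If $\mathsf V$ is the variety of representable $\ell$-groups, the minimal layer of $\mathcal P_{\mathsf V}(G)$ is homeomorphic to the space of orders on $\eta[G]$.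 (3) If $\mathsf V$ is the variety of Abelian $\ell$-groups, the minimal layer of $\mathcal P_{\mathsf V}(G)$ is homeomorphic to the space of orders on $\eta[G]$. -/

import Mathlib

universe u

namespace RightPreorders

/-! ### Lattice-ordered groups

A partially ordered group is a group with a partial order that is compatible with multiplication
on both sides: `[Group G] [PartialOrder G] [MulLeftMono G] [MulRightMono G]`.  An ℓ-group is a
partially ordered group whose order is a lattice order. -/

/-- A class of ℓ-groups. -/
abbrev LGroupClass : Type (u + 1) :=
  ∀ (H : Type u) [Group H] [Lattice H] [MulLeftMono H] [MulRightMono H], Prop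

/-- A group homomorphism between ℓ-groups that preserves binary suprema and infima. -/
def IsLHom {H K : Type*} [Group H] [Lattice H] [Group K] [Lattice K] (f : H →* K) : Prop :=
  (∀ a b, f (a ⊔ b) = f a ⊔ f b) ∧ ∀ a b, f (a ⊓ b) = f a ⊓ f b

/-- The variety of all ℓ-groups. -/
def AllLGroups : LGroupClass.{u} := fun _ _ _ _ _ => True

/-- The variety of representable ℓ-groups: subdirect products of totally ordered groups, that is,
ℓ-groups with a jointly injective family of surjective ℓ-homomorphisms onto totally ordered
groups. -/
def RepresentableLGroups : LGroupClass.{u} := fun H _ _ _ _ =>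
  ∃ (ι : Type u) (K : ι → Type u) (_ : ∀ i, Group (K i)) (_ : ∀ i, LinearOrder (K i))
    (_ : ∀ i, MulLeftMono (K i)) (_ : ∀ i, MulRightMono (K i)) (f : ∀ i, H →* K i),
    (∀ i, IsLHom (f i)) ∧ (∀ i, Function.Surjective (f i)) ∧
      ∀ a b : H, (∀ i, f i a = f i b) → a = b

/-- The variety of Abelian ℓ-groups. -/
def AbelianLGroups : LGroupClass.{u} := fun H _ _ _ _ => ∀ a b : H, a * b = b * a

/-- A sublattice subgroup of an ℓ-group. -/
structure LSubgroup (H : Type*) [Group H] [Lattice H] extends Subgroup H where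
  sup_mem' : ∀ ⦃a b : H⦄, a ∈ carrier → b ∈ carrier → a ⊔ b ∈ carrier
  inf_mem' : ∀ ⦃a b : H⦄, a ∈ carrier → b ∈ carrier → a ⊓ b ∈ carrier

/-- The ℓ-subgroup generated by a set: the intersection of all ℓ-subgroups containing it. -/
def LSubgroup.closure {H : Type*} [Group H] [Lattice H] (s : Set H) : LSubgroup H where
  carrier := {x | ∀ K : LSubgroup H, s ⊆ K.carrier → x ∈ K.carrier}
  one_mem' := fun K _ => K.one_mem'
  mul_mem' := fun ha hb K hK => K.mul_mem' (ha K hK) (hb K hK)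
  inv_mem' := fun ha K hK => K.inv_mem' (ha K hK)
  sup_mem' := fun _ _ ha hb K hK => K.sup_mem' (ha K hK) (hb K hK)
  inf_mem' := fun _ _ ha hb K hK => K.inf_mem' (ha K hK) (hb K hK)

instance {H : Type*} [Group H] [Lattice H] (K : LSubgroup H) : Lattice K.toSubgroup :=
  Subtype.lattice (fun {_ _} ha hb => K.sup_mem' ha hb) (fun {_ _} ha hb => K.inf_mem' ha hb)

instance {H : Type*} [Group H] [Lattice H] [MulLeftMono H] (K : LSubgroup H) :
    MulLeftMono K.toSubgroup :=
  ⟨fun a _ _ h => mul_le_mul_right (α := H) h (a : H)⟩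

instance {H : Type*} [Group H] [Lattice H] [MulRightMono H] (K : LSubgroup H) :
    MulRightMono K.toSubgroup :=
  ⟨fun a _ _ h => mul_le_mul_left (α := H) h (a : H)⟩

/-! ### The ℓ-group of automorphisms of a chain -/

/-- The order-preserving bijections of a chain, with the product `f * g` standing for
`g` after `f`, and with the pointwise order. -/
def ChainAut (Ω : Type*) [LinearOrder Ω] : Type _ := Ω ≃o Ω

namespace ChainAut

variable {Ω : Type*} [LinearOrder Ω]

instance : FunLike (ChainAut Ω) Ω Ω where
  coe f := ((show Ω ≃o Ω from f) : Ω → Ω)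
  coe_injective := fun _ _ h => DFunLike.coe_injective (F := Ω ≃o Ω) h

@[ext] theorem ext {f g : ChainAut Ω} (h : ∀ x, f x = g x) : f = g := DFunLike.ext f g h

instance : Group (ChainAut Ω) where
  mul f g := OrderIso.trans (show Ω ≃o Ω from f) (show Ω ≃o Ω from g)
  one := OrderIso.refl Ω
  inv f := OrderIso.symm (show Ω ≃o Ω from f)
  mul_assoc _ _ _ := rfl
  one_mul _ := rfl
  mul_one _ := rfl
  inv_mul_cancel f := OrderIso.symm_trans_self (show Ω ≃o Ω from f)

theorem mul_apply (f g : ChainAut Ω) (x : Ω) : (f * g) x = g (f x) := rfl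

theorem apply_le_apply (f : ChainAut Ω) {x y : Ω} : f x ≤ f y ↔ x ≤ y :=
  OrderIso.le_iff_le (show Ω ≃o Ω from f)

theorem apply_lt_apply (f : ChainAut Ω) {x y : Ω} : f x < f y ↔ x < y :=
  OrderIso.lt_iff_lt (show Ω ≃o Ω from f)

theorem inv_apply_apply (f : ChainAut Ω) (x : Ω) : f⁻¹ (f x) = x :=
  OrderIso.symm_apply_apply (show Ω ≃o Ω from f) x

theorem apply_inv_apply (f : ChainAut Ω) (x : Ω) : f (f⁻¹ x) = x :=
  OrderIso.apply_symm_apply (show Ω ≃o Ω from f) x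

theorem surj_sup (f g : ChainAut Ω) (y : Ω) : ∃ x, f x ⊔ g x = y := by
  rcases le_total (f⁻¹ y) (g⁻¹ y) with h | h
  · refine ⟨f⁻¹ y, ?_⟩
    rw [apply_inv_apply, sup_eq_left]
    calc g (f⁻¹ y) ≤ g (g⁻¹ y) := (apply_le_apply g).2 h
      _ = y := apply_inv_apply g y
  · refine ⟨g⁻¹ y, ?_⟩
    rw [apply_inv_apply, sup_eq_right]
    calc f (g⁻¹ y) ≤ f (f⁻¹ y) := (apply_le_apply f).2 h
      _ = y := apply_inv_apply f y

theorem surj_inf (f g : ChainAut Ω) (y : Ω) : ∃ x, f x ⊓ g x = y := by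
  rcases le_total (f⁻¹ y) (g⁻¹ y) with h | h
  · refine ⟨g⁻¹ y, ?_⟩
    rw [apply_inv_apply, inf_eq_right]
    calc y = f (f⁻¹ y) := (apply_inv_apply f y).symm
      _ ≤ f (g⁻¹ y) := (apply_le_apply f).2 h
  · refine ⟨f⁻¹ y, ?_⟩
    rw [apply_inv_apply, inf_eq_left]
    calc y = g (g⁻¹ y) := (apply_inv_apply g y).symm
      _ ≤ g (f⁻¹ y) := (apply_le_apply g).2 h

/-- The automorphism with a given strictly monotone surjective underlying map. -/
noncomputable def ofStrictMono (φ : Ω → Ω) (h : StrictMono φ) (hs : Function.Surjective φ) :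
    ChainAut Ω :=
  StrictMono.orderIsoOfSurjective φ h hs

theorem ofStrictMono_apply (φ : Ω → Ω) (h : StrictMono φ) (hs : Function.Surjective φ) (x : Ω) :
    ofStrictMono φ h hs x = φ x := rfl

instance : PartialOrder (ChainAut Ω) := PartialOrder.lift (fun f => (f : Ω → Ω)) DFunLike.coe_injective

theorem le_def {f g : ChainAut Ω} : f ≤ g ↔ ∀ x, f x ≤ g x := Iff.rfl

/-- The lattice operations are pointwise. -/
noncomputable instance : Lattice (ChainAut Ω) where
  sup f g := ofStrictMono (fun x => f x ⊔ g x)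
    (fun _ _ h => max_lt_max ((apply_lt_apply f).2 h) ((apply_lt_apply g).2 h)) (surj_sup f g)
  inf f g := ofStrictMono (fun x => f x ⊓ g x)
    (fun _ _ h => min_lt_min ((apply_lt_apply f).2 h) ((apply_lt_apply g).2 h)) (surj_inf f g)
  le_sup_left f g := fun x => (le_sup_left : f x ≤ f x ⊔ g x)
  le_sup_right f g := fun x => (le_sup_right : g x ≤ f x ⊔ g x)
  sup_le _ _ _ h₁ h₂ := fun x => sup_le (h₁ x) (h₂ x)
  inf_le_left f g := fun x => (inf_le_left : f x ⊓ g x ≤ f x)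
  inf_le_right f g := fun x => (inf_le_right : f x ⊓ g x ≤ g x)
  le_inf _ _ _ h₁ h₂ := fun x => le_inf (h₁ x) (h₂ x)

instance : MulLeftMono (ChainAut Ω) := ⟨fun f _ _ h x => h (f x)⟩

instance : MulRightMono (ChainAut Ω) := ⟨fun f _ _ h x => (apply_le_apply f).2 (h x)⟩

end ChainAut

/-! ### Right pre-orders, as pre-cones -/

section PreCones

/-- A pre-cone of a partially ordered group `G`: a proper submonoid `C` with `G = C ∪ C⁻¹` that
contains the positive cone of `G`.  It encodes the right pre-order `a ≼ b ↔ b * a⁻¹ ∈ C`. -/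
structure PreCone (G : Type u) [Group G] [PartialOrder G] extends Submonoid G where
  proper' : carrier ≠ Set.univ
  total' : ∀ a : G, a ∈ carrier ∨ a⁻¹ ∈ carrier
  pos_mem' : ∀ a : G, 1 ≤ a → a ∈ carrier

variable {G : Type u} [Group G] [PartialOrder G]

instance : SetLike (PreCone G) G where
  coe C := C.carrier
  coe_injective := by
    rintro ⟨C, _, _, _⟩ ⟨D, _, _, _⟩ h
    obtain rfl : C = D := SetLike.coe_injective h
    rfl

/-- Pre-cones are ordered by inclusion. -/
instance : PartialOrder (PreCone G) := PartialOrder.lift (fun C => (C : Set G)) SetLike.coe_injective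

namespace PreCone

theorem one_mem (C : PreCone G) : (1 : G) ∈ C := C.one_mem'

theorem mul_mem (C : PreCone G) {a b : G} (ha : a ∈ C) (hb : b ∈ C) : a * b ∈ C :=
  C.mul_mem' ha hb

/-- The right pre-order of a pre-cone. -/
def Rel (C : PreCone G) (a b : G) : Prop := b * a⁻¹ ∈ C

theorem rel_refl (C : PreCone G) (a : G) : C.Rel a a := by
  simpa [Rel] using C.one_mem

theorem rel_trans (C : PreCone G) {a b c : G} (h₁ : C.Rel a b) (h₂ : C.Rel b c) : C.Rel a c := by
  have h := C.mul_mem h₂ h₁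
  simpa [Rel, mul_assoc] using h

theorem rel_total (C : PreCone G) (a b : G) : C.Rel a b ∨ C.Rel b a := by
  have h : b * a⁻¹ ∈ C ∨ (b * a⁻¹)⁻¹ ∈ C := C.total' (b * a⁻¹)
  simpa [Rel] using h

theorem rel_mul_right_iff (C : PreCone G) (a b t : G) : C.Rel (a * t) (b * t) ↔ C.Rel a b := by
  simp [Rel, mul_assoc]

/-- The equivalence relation `a ≼ b ∧ b ≼ a`. -/
def setoid (C : PreCone G) : Setoid G where
  r a b := C.Rel a b ∧ C.Rel b a
  iseqv :=
    ⟨fun a => ⟨C.rel_refl a, C.rel_refl a⟩, fun h => ⟨h.2, h.1⟩,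
      fun h₁ h₂ => ⟨C.rel_trans h₁.1 h₂.1, C.rel_trans h₂.2 h₁.2⟩⟩

/-- The quotient `Ω_C` of `G` by the equivalence relation of the right pre-order. -/
def Chain (C : PreCone G) : Type u := Quotient C.setoid

/-- The class of `a` in `Ω_C`. -/
def cls (C : PreCone G) (a : G) : C.Chain := Quotient.mk C.setoid a

/-- The total order of `Ω_C`: `[a] ≤ [b] ↔ a ≼ b`. -/
noncomputable instance (C : PreCone G) : LinearOrder C.Chain where
  le := Quotient.lift₂ (s₁ := C.setoid) (s₂ := C.setoid) C.Rel (fun _ _ _ _ h₁ h₂ => propext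
    ⟨fun h => C.rel_trans (C.rel_trans h₁.2 h) h₂.1,
      fun h => C.rel_trans (C.rel_trans h₁.1 h) h₂.2⟩)
  le_refl := by rintro ⟨a⟩; exact C.rel_refl a
  le_trans := by rintro ⟨a⟩ ⟨b⟩ ⟨c⟩ h₁ h₂; exact C.rel_trans h₁ h₂
  le_antisymm := by rintro ⟨a⟩ ⟨b⟩ h₁ h₂; exact Quotient.sound ⟨h₁, h₂⟩
  le_total := by rintro ⟨a⟩ ⟨b⟩; exact C.rel_total a b
  toDecidableLE := Classical.decRel _

theorem cls_le_cls (C : PreCone G) (a b : G) : C.cls a ≤ C.cls b ↔ b * a⁻¹ ∈ C := Iff.rfl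

/-- Right multiplication by `a` on `Ω_C`, that is, `[b] ↦ [b * a]`. -/
def mulRight (C : PreCone G) (a : G) : C.Chain → C.Chain :=
  Quotient.map (sa := C.setoid) (sb := C.setoid) (fun b => b * a)
    (fun b c h => ⟨(C.rel_mul_right_iff b c a).2 h.1, (C.rel_mul_right_iff c b a).2 h.2⟩)

/-- The positive homomorphism `ρ_C : G → Aut Ω_C` with `ρ_C(a)([b]) = [b * a]`. -/
def rho (C : PreCone G) : G →* ChainAut C.Chain where
  toFun a := show C.Chain ≃o C.Chain from
    { toFun := C.mulRight a
      invFun := C.mulRight a⁻¹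
      left_inv := by
        rintro ⟨b⟩
        exact congrArg C.cls (mul_inv_cancel_right b a)
      right_inv := by
        rintro ⟨b⟩
        exact congrArg C.cls (inv_mul_cancel_right b a)
      map_rel_iff' := by
        rintro ⟨b⟩ ⟨c⟩
        exact C.rel_mul_right_iff b c a }
  map_one' := by
    refine ChainAut.ext ?_
    rintro ⟨b⟩
    exact congrArg C.cls (mul_one b)
  map_mul' a a' := by
    refine ChainAut.ext ?_
    rintro ⟨b⟩
    exact congrArg C.cls (mul_assoc b a a').symm

theorem rho_cls (C : PreCone G) (a b : G) : C.rho a (C.cls b) = C.cls (b * a) := rfl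

/-- The ℓ-group `H_C`: the ℓ-subgroup of `Aut Ω_C` generated by the image of `ρ_C`. -/
abbrev LGroupOf (C : PreCone G) : Type u :=
  (LSubgroup.closure (Set.range C.rho)).toSubgroup

/-- The right pre-order of `C` is antisymmetric, that is, `C ∩ C⁻¹ = {1}`. -/
def IsRightOrder (C : PreCone G) : Prop := ∀ a, a ∈ C → a⁻¹ ∈ C → a = 1

/-- `C` is closed under conjugation, that is, its right pre-order is also left invariant. -/
def IsNormal (C : PreCone G) : Prop := ∀ a ∈ C, ∀ g : G, g * a * g⁻¹ ∈ C

/-- The smallest topology in which all the sets `{C | a ∈ C ∧ a⁻¹ ∉ C}` are open. -/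
instance : TopologicalSpace (PreCone G) :=
  TopologicalSpace.generateFrom (Set.range fun a : G => {C : PreCone G | a ∈ C ∧ a⁻¹ ∉ C})

end PreCone

variable (V : LGroupClass.{u}) (G)

/-- The right pre-orders `C` on `G` such that `H_C` lies in `V`.  As a subspace of `PreCone G` it
carries the smallest topology containing all the sets `{C | a ∈ C ∧ a⁻¹ ∉ C}`. -/
def VPreCones : Set (PreCone G) := {C | V C.LGroupOf}

/-- The minimal layer: the space of inclusion-minimal right pre-orders of the class `V`. -/
def MinimalLayer : Set (PreCone G) := {C | Minimal (· ∈ VPreCones G V) C}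

/-- The space of right orders on `G`. -/
def RightOrders : Set (PreCone G) := {C | C.IsRightOrder}

/-- The space of orders on `G`: the right orders that are also left invariant. -/
def BiOrders : Set (PreCone G) := {C | C.IsRightOrder ∧ C.IsNormal}

end PreCones

/-! ### The free ℓ-group in a class over a partially ordered group -/

/-- ℓ-group terms with variables from `G`. -/
inductive LTerm (G : Type u) : Type u
  | of : G → LTerm G
  | one : LTerm G
  | mul : LTerm G → LTerm G → LTerm G
  | inv : LTerm G → LTerm G
  | sup : LTerm G → LTerm G → LTerm G
  | inf : LTerm G → LTerm G → LTerm G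

/-- The value of a term under an assignment of the variables. -/
def LTerm.eval {G : Type u} {H : Type*} [Group H] [Lattice H] (p : G → H) : LTerm G → H
  | .of g => p g
  | .one => 1
  | .mul s t => s.eval p * t.eval p
  | .inv s => (s.eval p)⁻¹
  | .sup s t => s.eval p ⊔ t.eval p
  | .inf s t => s.eval p ⊓ t.eval p

section Free

variable (V : LGroupClass.{u}) (G : Type u) [Group G] [PartialOrder G]

/-- The inequality `s ≤ t` holds under every positive homomorphism from `G` to an ℓ-group
in `V`. -/
def LTerm.Le (s t : LTerm G) : Prop :=
  ∀ (H : Type u) [Group H] [Lattice H] [MulLeftMono H] [MulRightMono H], V H →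
    ∀ p : G →* H, Monotone p → s.eval p ≤ t.eval p

/-- Two terms are identified when they have the same value under every positive homomorphism from
`G` to an ℓ-group in `V`. -/
def LTerm.setoid : Setoid (LTerm G) where
  r s t := LTerm.Le V G s t ∧ LTerm.Le V G t s
  iseqv :=
    ⟨fun _ => ⟨fun _ _ _ _ _ _ _ _ => le_rfl, fun _ _ _ _ _ _ _ _ => le_rfl⟩,
      fun h => ⟨h.2, h.1⟩,
      fun h₁ h₂ => ⟨fun H _ _ _ _ hH p hp => (h₁.1 H hH p hp).trans (h₂.1 H hH p hp),
        fun H _ _ _ _ hH p hp => (h₂.2 H hH p hp).trans (h₁.2 H hH p hp)⟩⟩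

/-- The ℓ-group free over `G` in `V`; see `FreeLGroup.universal` for its universal property. -/
def FreeLGroup : Type u := Quotient (LTerm.setoid V G)

namespace FreeLGroup

variable {V G}

/-- The class of a term. -/
def mk (t : LTerm G) : FreeLGroup V G := Quotient.mk (LTerm.setoid V G) t

theorem sound {s t : LTerm G}
    (h : ∀ (H : Type u) [Group H] [Lattice H] [MulLeftMono H] [MulRightMono H], V H →
      ∀ p : G →* H, Monotone p → s.eval p = t.eval p) :
    (mk s : FreeLGroup V G) = mk t :=
  Quotient.sound ⟨fun H _ _ _ _ hH p hp => (h H hH p hp).le,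
    fun H _ _ _ _ hH p hp => (h H hH p hp).ge⟩

theorem eval_eq {s t : LTerm G} (h : LTerm.setoid V G s t) {H : Type u} [Group H] [Lattice H]
    [MulLeftMono H] [MulRightMono H] (hH : V H) (p : G →* H) (hp : Monotone p) :
    s.eval p = t.eval p :=
  le_antisymm (h.1 H hH p hp) (h.2 H hH p hp)

theorem rel_of {s t : LTerm G}
    (h : ∀ (H : Type u) [Group H] [Lattice H] [MulLeftMono H] [MulRightMono H], V H →
      ∀ p : G →* H, Monotone p → s.eval p = t.eval p) : LTerm.setoid V G s t :=
  ⟨fun H _ _ _ _ hH p hp => (h H hH p hp).le, fun H _ _ _ _ hH p hp => (h H hH p hp).ge⟩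

instance : Group (FreeLGroup V G) where
  mul := Quotient.map₂ (sa := LTerm.setoid V G) (sb := LTerm.setoid V G) (sc := LTerm.setoid V G)
    LTerm.mul (fun _ _ h₁ _ _ h₂ => rel_of fun H _ _ _ _ hH p hp =>
      congrArg₂ (· * ·) (eval_eq h₁ hH p hp) (eval_eq h₂ hH p hp))
  one := mk LTerm.one
  inv := Quotient.map (sa := LTerm.setoid V G) (sb := LTerm.setoid V G)
    LTerm.inv (fun _ _ h => rel_of fun H _ _ _ _ hH p hp =>
      congrArg (·⁻¹) (eval_eq h hH p hp))
  mul_assoc := by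
    rintro ⟨a⟩ ⟨b⟩ ⟨c⟩
    exact sound fun H _ _ _ _ _ p _ => mul_assoc _ _ _
  one_mul := by
    rintro ⟨a⟩
    exact sound fun H _ _ _ _ _ p _ => one_mul _
  mul_one := by
    rintro ⟨a⟩
    exact sound fun H _ _ _ _ _ p _ => mul_one _
  inv_mul_cancel := by
    rintro ⟨a⟩
    exact sound fun H _ _ _ _ _ p _ => inv_mul_cancel _

instance : Lattice (FreeLGroup V G) where
  le := Quotient.lift₂ (s₁ := LTerm.setoid V G) (s₂ := LTerm.setoid V G) (LTerm.Le V G)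
    (fun _ _ _ _ h₁ h₂ => propext
      ⟨fun h H _ _ _ _ hH p hp =>
        (h₁.2 H hH p hp).trans ((h H hH p hp).trans (h₂.1 H hH p hp)),
      fun h H _ _ _ _ hH p hp =>
        (h₁.1 H hH p hp).trans ((h H hH p hp).trans (h₂.2 H hH p hp))⟩)
  le_refl := by rintro ⟨a⟩ H _ _ _ _ hH p hp; exact le_rfl
  le_trans := by
    rintro ⟨a⟩ ⟨b⟩ ⟨c⟩ h₁ h₂ H _ _ _ _ hH p hp
    exact (h₁ H hH p hp).trans (h₂ H hH p hp)
  le_antisymm := by rintro ⟨a⟩ ⟨b⟩ h₁ h₂; exact Quotient.sound ⟨h₁, h₂⟩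
  sup := Quotient.map₂ (sa := LTerm.setoid V G) (sb := LTerm.setoid V G) (sc := LTerm.setoid V G)
    LTerm.sup (fun _ _ h₁ _ _ h₂ => rel_of fun H _ _ _ _ hH p hp =>
      congrArg₂ (· ⊔ ·) (eval_eq h₁ hH p hp) (eval_eq h₂ hH p hp))
  inf := Quotient.map₂ (sa := LTerm.setoid V G) (sb := LTerm.setoid V G) (sc := LTerm.setoid V G)
    LTerm.inf (fun _ _ h₁ _ _ h₂ => rel_of fun H _ _ _ _ hH p hp =>
      congrArg₂ (· ⊓ ·) (eval_eq h₁ hH p hp) (eval_eq h₂ hH p hp))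
  le_sup_left := by rintro ⟨a⟩ ⟨b⟩ H _ _ _ _ hH p hp; exact le_sup_left
  le_sup_right := by rintro ⟨a⟩ ⟨b⟩ H _ _ _ _ hH p hp; exact le_sup_right
  sup_le := by
    rintro ⟨a⟩ ⟨b⟩ ⟨c⟩ h₁ h₂ H _ _ _ _ hH p hp
    exact sup_le (h₁ H hH p hp) (h₂ H hH p hp)
  inf_le_left := by rintro ⟨a⟩ ⟨b⟩ H _ _ _ _ hH p hp; exact inf_le_left
  inf_le_right := by rintro ⟨a⟩ ⟨b⟩ H _ _ _ _ hH p hp; exact inf_le_right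
  le_inf := by
    rintro ⟨a⟩ ⟨b⟩ ⟨c⟩ h₁ h₂ H _ _ _ _ hH p hp
    exact le_inf (h₁ H hH p hp) (h₂ H hH p hp)

instance : MulLeftMono (FreeLGroup V G) := ⟨by
  rintro ⟨a⟩ ⟨b⟩ ⟨c⟩ h H _ _ _ _ hH p hp
  exact mul_le_mul_right (h H hH p hp) _⟩

instance : MulRightMono (FreeLGroup V G) := ⟨by
  rintro ⟨a⟩ ⟨b⟩ ⟨c⟩ h H _ _ _ _ hH p hp
  exact mul_le_mul_left (h H hH p hp) _⟩

variable (V G)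

/-- The universal map `η : G → F(G)`. -/
def eta : G →* FreeLGroup V G where
  toFun g := mk (LTerm.of g)
  map_one' := sound fun _ _ _ _ _ _ p _ => map_one p
  map_mul' a b := sound fun _ _ _ _ _ _ p _ => map_mul p a b

/-- The partially ordered group `η[G]`: the image of `G` under `η`, with the order restricted from
the free ℓ-group. -/
abbrev EtaImage : Type u := (eta V G).range

variable {V G}

theorem eta_monotone : Monotone (eta V G) :=
  fun _ _ h _ _ _ _ _ _ _ hp => hp h

/-- The ℓ-homomorphism from the free ℓ-group induced by a positive homomorphism. -/
def lift {H : Type u} [Group H] [Lattice H] [MulLeftMono H] [MulRightMono H] (hH : V H)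
    (p : G →* H) (hp : Monotone p) : FreeLGroup V G →* H where
  toFun := Quotient.lift (s := LTerm.setoid V G) (LTerm.eval p) (fun _ _ h => eval_eq h hH p hp)
  map_one' := rfl
  map_mul' := by rintro ⟨a⟩ ⟨b⟩; rfl

theorem lift_mk {H : Type u} [Group H] [Lattice H] [MulLeftMono H] [MulRightMono H] (hH : V H)
    (p : G →* H) (hp : Monotone p) (t : LTerm G) : lift hH p hp (mk t) = t.eval p := rfl

theorem lift_isLHom {H : Type u} [Group H] [Lattice H] [MulLeftMono H] [MulRightMono H] (hH : V H)
    (p : G →* H) (hp : Monotone p) : IsLHom (lift hH p hp) := by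
  constructor
  · rintro ⟨a⟩ ⟨b⟩; rfl
  · rintro ⟨a⟩ ⟨b⟩; rfl

/-- The universal property of the free ℓ-group over `G` in `V`. -/
theorem universal {H : Type u} [Group H] [Lattice H] [MulLeftMono H] [MulRightMono H] (hH : V H)
    (p : G →* H) (hp : Monotone p) :
    ∃! h : FreeLGroup V G →* H, IsLHom h ∧ h.comp (eta V G) = p := by
  refine ⟨lift hH p hp, ⟨lift_isLHom hH p hp, MonoidHom.ext fun _ => rfl⟩, ?_⟩
  rintro h ⟨hl, hc⟩
  refine MonoidHom.ext ?_
  rintro ⟨t⟩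
  change h (mk t) = t.eval p
  induction t with
  | of g => exact DFunLike.congr_fun hc g
  | one => exact map_one h
  | mul s t hs ht => exact (map_mul h (mk s) (mk t)).trans (congrArg₂ (· * ·) hs ht)
  | inv s hs => exact (map_inv h (mk s)).trans (congrArg (·⁻¹) hs)
  | sup s t hs ht => exact (hl.1 (mk s) (mk t)).trans (congrArg₂ (· ⊔ ·) hs ht)
  | inf s t hs ht => exact (hl.2 (mk s) (mk t)).trans (congrArg₂ (· ⊓ ·) hs ht)

theorem mem_all : AllLGroups (FreeLGroup AllLGroups G) := trivial

theorem mem_abelian : AbelianLGroups (FreeLGroup AbelianLGroups G) := by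
  rintro ⟨a⟩ ⟨b⟩
  exact sound fun H _ _ _ _ hH p _ => hH _ _

/-- Terms of the free representable ℓ-group are separated by positive homomorphisms to totally
ordered groups. -/
theorem exists_chain {s t : LTerm G} (h : ¬ (mk s : FreeLGroup RepresentableLGroups G) = mk t) :
    ∃ (K : Type u) (_ : Group K) (_ : LinearOrder K) (_ : MulLeftMono K) (_ : MulRightMono K)
      (f : FreeLGroup RepresentableLGroups G →* K),
      IsLHom f ∧ Function.Surjective f ∧ f (mk s) ≠ f (mk t) := by
  by_contra hne
  apply h
  refine sound fun H _ _ _ _ hH p hp => ?_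
  obtain ⟨ι, K, _, _, _, _, f, hf, -, hinj⟩ := id hH
  refine hinj _ _ fun i => ?_
  by_contra hst
  let g : FreeLGroup RepresentableLGroups G →* K i := (f i).comp (lift hH p hp)
  have hg : IsLHom g := by
    have hl := lift_isLHom hH p hp
    constructor
    · intro a b
      change f i (lift hH p hp (a ⊔ b)) = _
      rw [hl.1, (hf i).1]; rfl
    · intro a b
      change f i (lift hH p hp (a ⊓ b)) = _
      rw [hl.2, (hf i).2]; rfl
  refine hne ⟨g.range, inferInstance, inferInstance, ⟨fun a _ _ h => ?_⟩, ⟨fun a _ _ h => ?_⟩,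
    g.rangeRestrict, ⟨fun a b => ?_, fun a b => ?_⟩, g.rangeRestrict_surjective, fun he => ?_⟩
  · exact mul_le_mul_right (α := K i) h (a : K i)
  · exact mul_le_mul_left (α := K i) h (a : K i)
  · apply Subtype.ext
    exact (hg.1 a b).trans (Monotone.map_sup (f := fun x : g.range => (x : K i))
      (fun _ _ h => h) (g.rangeRestrict a) (g.rangeRestrict b)).symm
  · apply Subtype.ext
    exact (hg.2 a b).trans (Monotone.map_inf (f := fun x : g.range => (x : K i))
      (fun _ _ h => h) (g.rangeRestrict a) (g.rangeRestrict b)).symm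
  · exact hst (congrArg Subtype.val he)

theorem mem_representable :
    RepresentableLGroups (FreeLGroup RepresentableLGroups G) := by
  classical
  have key : ∀ i : {q : FreeLGroup RepresentableLGroups G × FreeLGroup RepresentableLGroups G //
      q.1 ≠ q.2},
      ∃ (K : Type u) (_ : Group K) (_ : LinearOrder K) (_ : MulLeftMono K) (_ : MulRightMono K)
      (f : FreeLGroup RepresentableLGroups G →* K),
      IsLHom f ∧ Function.Surjective f ∧ f i.1.1 ≠ f i.1.2 := by
    rintro ⟨⟨⟨s⟩, ⟨t⟩⟩, h⟩
    exact exists_chain h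
  choose K i₁ i₂ i₃ i₄ f h₁ h₂ h₃ using key
  refine ⟨_, K, i₁, i₂, i₃, i₄, f, h₁, h₂, fun a b hab => ?_⟩
  by_contra hne
  exact h₃ ⟨(a, b), hne⟩ (hab _)

end FreeLGroup

end Free

end RightPreorders

open RightPreorders

namespace RightPreorders

/-! ### Constructions of pre-cones -/

namespace PreCone

variable {G : Type u} [Group G] [PartialOrder G]

/-! For `C` in `VPreCones G V`, `rho` gives a positive homomorphism into an ℓ-group of `V`, so `C`
contains every `a` with `1 ≤ η(a)`. Hence `C` is the preimage of a pre-cone of `η[G]`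
(`PreCone.exists_etaComap_eq`), and taking preimages is a topological embedding. It remains to see
which pre-cones of `η[G]` have minimal preimages. The answer is uniform
(`nonempty_minimalLayer_homeomorph`) once `VPreCones G V` has a coinitial subclass `P` closed under
`lex` that separates: all pre-cones, the normal ones, or those containing all commutators. The
preimage of a right order cannot shrink: a removed `a` would leave `a⁻¹` behind and force `η(a) =
1`. Conversely, if `a` and `a⁻¹` lie in a minimal `C` but `η(a) ≠ 1`, some `D` in `P` misses one of
them, and `C.lex D` is strictly smaller. Separation rests on `exists_total_submonoid`; coinitiality
in the representable case on an ultraproduct of chains (`exists_isNormal_le`). -/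

theorem pos_mem (C : PreCone G) {a : G} (ha : 1 ≤ a) : a ∈ C := C.pos_mem' a ha

theorem inv_mem_of_not_mem (C : PreCone G) {a : G} (ha : a ∉ C) : a⁻¹ ∈ C :=
  (C.total' a).resolve_left ha

theorem exists_not_mem (C : PreCone G) : ∃ a, a ∉ C := (Set.ne_univ_iff_exists_notMem _).1 C.proper'

/-- The pre-cone given by a total submonoid containing the positive cone and missing `x`. -/
def ofNotMem (M : Submonoid G) (total : ∀ a, a ∈ M ∨ a⁻¹ ∈ M) (pos : ∀ a, 1 ≤ a → a ∈ M)
    (x : G) (hx : x ∉ M) : PreCone G where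
  toSubmonoid := M
  proper' h := hx (h.ge (Set.mem_univ x))
  total' := total
  pos_mem' := pos

/-- The preimage of a pre-cone under a surjective positive homomorphism. -/
def comap {G' : Type u} [Group G'] [PartialOrder G'] (f : G →* G') (hf : Monotone f)
    (hs : Function.Surjective f) (D : PreCone G') : PreCone G where
  toSubmonoid := D.toSubmonoid.comap f
  proper' h := by
    obtain ⟨x, hx⟩ := D.exists_not_mem
    obtain ⟨a, rfl⟩ := hs x
    exact hx (h.ge (Set.mem_univ a))
  total' a := by
    change f a ∈ D ∨ f a⁻¹ ∈ D
    rw [map_inv]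
    exact D.total' (f a)
  pos_mem' a ha := D.pos_mem ((map_one f).symm.le.trans (hf ha))

theorem mem_comap {G' : Type u} [Group G'] [PartialOrder G'] {f : G →* G'} {hf : Monotone f}
    {hs : Function.Surjective f} {D : PreCone G'} {a : G} : a ∈ D.comap f hf hs ↔ f a ∈ D := Iff.rfl

theorem isEmbedding_comap {G' : Type u} [Group G'] [PartialOrder G'] (f : G →* G')
    (hf : Monotone f) (hs : Function.Surjective f) :
    Topology.IsEmbedding (comap f hf hs) := by
  refine ⟨⟨?_⟩, fun D E h => SetLike.ext fun x => ?_⟩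
  · refine Eq.trans ?_ induced_generateFrom_eq.symm
    refine congrArg TopologicalSpace.generateFrom ?_
    rw [← Set.range_comp, ← hs.range_comp]
    refine congrArg Set.range (funext fun a => Set.ext fun D => ?_)
    simp [mem_comap]
  · obtain ⟨a, rfl⟩ := hs x
    exact SetLike.ext_iff.1 h a

/-- The refinement of the pre-cone `C` that decides the elements of `C ∩ C⁻¹` by the
pre-cone `D`. -/
def lex (C D : PreCone G) : PreCone G where
  carrier := {a | a ∈ C ∧ (a⁻¹ ∈ C → a ∈ D)}
  one_mem' := ⟨C.one_mem, fun _ => D.one_mem⟩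
  mul_mem' := by
    rintro a b ⟨ha, ha'⟩ ⟨hb, hb'⟩
    refine ⟨C.mul_mem ha hb, fun h => ?_⟩
    -- Since `a⁻¹ = b * (a * b)⁻¹` and `b⁻¹ = (a * b)⁻¹ * a`, a product lies in `C ∩ C⁻¹` only if
    -- both factors do.
    have h₁ : a⁻¹ ∈ C := by simpa using C.mul_mem hb h
    have h₂ : b⁻¹ ∈ C := by simpa using C.mul_mem h ha
    exact D.mul_mem (ha' h₁) (hb' h₂)
  proper' h := by
    obtain ⟨x, hx⟩ := C.exists_not_mem
    exact hx (h.ge (Set.mem_univ x)).1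
  total' a := by
    by_cases ha : a ∈ C
    · by_cases ha' : a⁻¹ ∈ C
      · rcases D.total' a with h | h
        · exact Or.inl ⟨ha, fun _ => h⟩
        · exact Or.inr ⟨ha', fun _ => h⟩
      · exact Or.inl ⟨ha, fun h => absurd h ha'⟩
    · exact Or.inr ⟨C.inv_mem_of_not_mem ha, fun h => absurd (by simpa using h) ha⟩
  pos_mem' a ha := ⟨C.pos_mem ha, fun _ => D.pos_mem ha⟩

theorem lex_le (C D : PreCone G) : C.lex D ≤ C := fun _ h => h.1

theorem IsNormal.lex {C D : PreCone G} (hC : C.IsNormal) (hD : D.IsNormal) :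
    (C.lex D).IsNormal := by
  rintro a ⟨ha, ha'⟩ g
  refine ⟨hC a ha g, fun h => hD a (ha' ?_) g⟩
  simpa [mul_assoc] using hC _ h g⁻¹

/-- The pre-cone `C` contains all commutators. -/
def HasCommutators (C : PreCone G) : Prop := ∀ a b : G, a * b * a⁻¹ * b⁻¹ ∈ C

/-- Write `g * a * g⁻¹` as the commutator of `g` and `a`, times `a`. -/
theorem HasCommutators.isNormal {C : PreCone G} (hC : C.HasCommutators) : C.IsNormal :=
  fun a ha g => by simpa using C.mul_mem (hC g a) ha

theorem HasCommutators.lex {C D : PreCone G} (hC : C.HasCommutators) (hD : D.HasCommutators) :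
    (C.lex D).HasCommutators := fun a b => ⟨hC a b, fun _ => hD a b⟩

end PreCone

/-! ### The ℓ-group of a pre-cone -/

namespace PreCone

variable {G : Type u} [Group G] [PartialOrder G]

/-- The generator of `H_C` given by an element of `G`. -/
noncomputable def toLGroupOf (C : PreCone G) : G →* C.LGroupOf :=
  C.rho.codRestrict _ fun a _ hK => hK ⟨a, rfl⟩

/-- The order on automorphisms is pointwise, and evaluating at `[c]` produces the conjugate by `c`.
Membership of `b * a⁻¹` itself is the evaluation at `[1]`. -/
theorem rho_le_rho (C : PreCone G) (a b : G) :
    C.rho a ≤ C.rho b ↔ ∀ c : G, c * (b * a⁻¹) * c⁻¹ ∈ C := by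
  constructor
  · intro h c
    have h' : C.cls (c * a) ≤ C.cls (c * b) := h (C.cls c)
    simpa [cls_le_cls, mul_assoc] using h'
  · rintro h ⟨c⟩
    change C.cls (c * a) ≤ C.cls (c * b)
    simpa [cls_le_cls, mul_assoc] using h c

theorem IsNormal.rho_le_rho {C : PreCone G} (hC : C.IsNormal) (a b : G) :
    C.rho a ≤ C.rho b ↔ b * a⁻¹ ∈ C := by
  rw [PreCone.rho_le_rho]
  exact ⟨fun h => by simpa using h 1, fun h c => hC _ h c⟩

theorem mem_of_rho_eq_one {C : PreCone G} {a : G} (h : C.rho a = 1) : a ∈ C := by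
  have h' : C.rho 1 ≤ C.rho a := by rw [h, map_one]
  simpa using (C.rho_le_rho 1 a).1 h' 1

theorem monotone_toLGroupOf [MulLeftMono G] [MulRightMono G] (C : PreCone G) :
    Monotone C.toLGroupOf := by
  intro a b h
  refine (C.rho_le_rho a b).2 fun c => C.pos_mem ?_
  have h₁ : 1 ≤ b * a⁻¹ := by simpa using h
  calc (1 : G) = c * 1 * c⁻¹ := by simp
    _ ≤ c * (b * a⁻¹) * c⁻¹ := mul_le_mul_left (mul_le_mul_right h₁ c) c⁻¹

theorem IsNormal.rho_total {C : PreCone G} (hC : C.IsNormal) (a b : G) :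
    C.rho a ≤ C.rho b ∨ C.rho b ≤ C.rho a := by
  rw [hC.rho_le_rho, hC.rho_le_rho]
  exact C.rel_total a b

/-- The ℓ-group of a normal pre-cone consists of the generators. -/
theorem IsNormal.toLGroupOf_surjective {C : PreCone G} (hC : C.IsNormal) :
    Function.Surjective C.toLGroupOf := by
  rintro ⟨x, hx⟩
  -- Any two generators are comparable, so the range of `rho` is already closed under the lattice
  -- operations.
  let K : LSubgroup (ChainAut C.Chain) :=
    { C.rho.range with
      sup_mem' := by
        rintro _ _ ⟨a, rfl⟩ ⟨b, rfl⟩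
        rcases hC.rho_total a b with h | h
        · rw [sup_eq_right.2 h]; exact ⟨b, rfl⟩
        · rw [sup_eq_left.2 h]; exact ⟨a, rfl⟩
      inf_mem' := by
        rintro _ _ ⟨a, rfl⟩ ⟨b, rfl⟩
        rcases hC.rho_total a b with h | h
        · rw [inf_eq_left.2 h]; exact ⟨a, rfl⟩
        · rw [inf_eq_right.2 h]; exact ⟨b, rfl⟩ }
  obtain ⟨a, ha⟩ := hx K (fun _ h => h)
  exact ⟨a, Subtype.ext ha⟩

/-- Here `H_C` is itself a chain, so the identity map alone is a subdirect representation. -/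
theorem IsNormal.mem_representable {C : PreCone G} (hC : C.IsNormal) :
    C ∈ VPreCones G RepresentableLGroups := by
  classical
  have ht : ∀ x y : C.LGroupOf, x ≤ y ∨ y ≤ x := by
    intro x y
    obtain ⟨a, rfl⟩ := hC.toLGroupOf_surjective x
    obtain ⟨b, rfl⟩ := hC.toLGroupOf_surjective y
    exact hC.rho_total a b
  have : Std.Total (α := C.LGroupOf) (· ≤ ·) := ⟨ht⟩
  let L : LinearOrder C.LGroupOf := Lattice.toLinearOrder C.LGroupOf
  exact ⟨PUnit, fun _ => C.LGroupOf, fun _ => inferInstance, fun _ => L,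
    fun _ => inferInstanceAs (MulLeftMono C.LGroupOf),
    fun _ => inferInstanceAs (MulRightMono C.LGroupOf), fun _ => MonoidHom.id _,
    fun _ => ⟨fun _ _ => rfl, fun _ _ => rfl⟩, fun _ => Function.surjective_id,
    fun _ _ h => h PUnit.unit⟩

/-- Commutators in `C` give `ρ(ab) ≤ ρ(ba)`, and by symmetry equality; the generators exhaust `H_C`.
-/
theorem HasCommutators.mem_abelian {C : PreCone G} (hC : C.HasCommutators) :
    C ∈ VPreCones G AbelianLGroups := by
  have key : ∀ a b, C.toLGroupOf (a * b) ≤ C.toLGroupOf (b * a) := fun a b =>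
    (hC.isNormal.rho_le_rho _ _).2 (by simpa [mul_assoc] using hC b a)
  intro x y
  obtain ⟨a, rfl⟩ := hC.isNormal.toLGroupOf_surjective x
  obtain ⟨b, rfl⟩ := hC.isNormal.toLGroupOf_surjective y
  rw [← map_mul, ← map_mul]
  exact le_antisymm (key a b) (key b a)

theorem hasCommutators_of_mem_abelian {C : PreCone G} (hC : C ∈ VPreCones G AbelianLGroups) :
    C.HasCommutators := by
  intro a b
  refine mem_of_rho_eq_one ?_
  have h : C.rho a * C.rho b = C.rho b * C.rho a :=
    congrArg Subtype.val (hC (C.toLGroupOf a) (C.toLGroupOf b))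
  simp [h]

end PreCone

/-! ### Normal pre-cones below a representable one -/

theorem IsLHom.monotone {H K : Type*} [Group H] [Lattice H] [Group K] [Lattice K] {f : H →* K}
    (hf : IsLHom f) : Monotone f := fun a b h => by
  rw [← sup_eq_right, ← hf.1, sup_eq_right.2 h]

/-- In a subdirect product of chains, an element is positive when its components are. -/
theorem one_le_of_forall_isLHom {H : Type*} [Group H] [Lattice H] {ι : Type*} {K : ι → Type*}
    [∀ i, Group (K i)] [∀ i, LinearOrder (K i)] {f : ∀ i, H →* K i} (hf : ∀ i, IsLHom (f i))
    (hinj : ∀ a b : H, (∀ i, f i a = f i b) → a = b) {a : H} (ha : ∀ i, 1 ≤ f i a) : 1 ≤ a := by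
  rw [← inf_eq_left]
  refine hinj _ _ fun i => ?_
  rw [(hf i).2, map_one, inf_eq_left.2 (ha i)]

namespace PreCone

variable {G : Type u} [Group G] [PartialOrder G]

/-- A pre-cone whose ℓ-group is representable contains a normal pre-cone: an ultraproduct of the
chains in a subdirect representation provides one. -/
theorem exists_isNormal_le [MulLeftMono G] [MulRightMono G] {C : PreCone G}
    (hC : C ∈ VPreCones G RepresentableLGroups) : ∃ D : PreCone G, D.IsNormal ∧ D ≤ C := by
  obtain ⟨ι, K, _, _, _, _, f, hf, -, hinj⟩ := id hC
  let e : C.Chain := C.cls 1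
  -- For each `h` that moves `[1]` strictly down, take the set of coordinates where `h` is strictly
  -- negative. Every `a ∉ C` supplies such an `h`.
  let B : Set (Set ι) := {s | ∃ h : C.LGroupOf, h.1 e < e ∧ s = {i | f i h < 1}}
  have hB : ∀ a : G, a ∉ C → ∃ h : C.LGroupOf, h.1 e < e ∧ h = C.toLGroupOf a := by
    intro a ha
    refine ⟨_, lt_of_not_ge fun h => ha ?_, rfl⟩
    have h' : C.cls 1 ≤ C.cls (1 * a) := h
    simpa [cls_le_cls] using h'
  obtain ⟨x, hx⟩ := C.exists_not_mem
  have hdir : DirectedOn (· ≥ ·) B := by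
    rintro _ ⟨h, hh, rfl⟩ _ ⟨k, hk, rfl⟩
    -- Joins are pointwise on a chain, so `h ⊔ k` still moves `[1]` down, and where it is negative
    -- so are `h` and `k`.
    refine ⟨_, ⟨h ⊔ k, ?_, rfl⟩, fun i hi => ?_, fun i hi => ?_⟩
    · exact (max_lt hh hk : h.1 e ⊔ k.1 e < e)
    · exact ((hf i).monotone le_sup_left).trans_lt hi
    · exact ((hf i).monotone le_sup_right).trans_lt hi
  have hne : (⨅ s : B, Filter.principal (s : Set ι)).NeBot := by
    have : Nonempty B := by
      obtain ⟨h, hh, -⟩ := hB x hx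
      exact ⟨⟨_, h, hh, rfl⟩⟩
    refine Filter.iInf_neBot_of_directed' ?_ ?_
    · rintro ⟨s, hs⟩ ⟨t, ht⟩
      obtain ⟨r, hr, h₁, h₂⟩ := hdir s hs t ht
      exact ⟨⟨r, hr⟩, Filter.principal_mono.2 h₁, Filter.principal_mono.2 h₂⟩
    · rintro ⟨s, h, hh, rfl⟩
      rw [Filter.principal_neBot_iff]
      by_contra hempty
      rw [Set.not_nonempty_iff_eq_empty, Set.eq_empty_iff_forall_notMem] at hempty
      have h₁ : 1 ≤ h := one_le_of_forall_isLHom hf hinj fun i => not_lt.1 (hempty i)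
      exact absurd hh (not_lt.2 (h₁ e))
  let U : Ultrafilter ι := Ultrafilter.of (⨅ s : B, Filter.principal (s : Set ι))
  have hU : ∀ a : G, a ∉ C → ∀ᶠ i in (U : Filter ι), f i (C.toLGroupOf a) < 1 := by
    intro a ha
    obtain ⟨h, hh, rfl⟩ := hB a ha
    exact Ultrafilter.of_le _ (Filter.mem_iInf_of_mem ⟨_, _, hh, rfl⟩ (Filter.mem_principal_self _))
  -- This is the preimage of the positive cone of the ultraproduct of the `K i` along `U`, a totally
  -- ordered group; hence it is total and normal. Elements outside `C` become strictly negative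
  -- there, so `M` lies inside `C`.
  let M : Submonoid G :=
    { carrier := {a | ∀ᶠ i in (U : Filter ι), 1 ≤ f i (C.toLGroupOf a)}
      one_mem' := Filter.Eventually.of_forall fun i => by simp
      mul_mem' := by
        intro a b ha hb
        filter_upwards [ha, hb] with i h₁ h₂
        rw [map_mul, map_mul]
        exact one_le_mul h₁ h₂ }
  have hM : ∀ {a : G}, a ∈ M → a ∈ C := by
    intro a ha
    by_contra hne
    have h := (hU a hne).and ha
    obtain ⟨i, h₁, h₂⟩ := h.exists
    exact absurd h₁ (not_lt.2 h₂)
  refine ⟨ofNotMem M (fun a => ?_) (fun a ha => ?_) x (fun h => hx (hM h)), fun a ha g => ?_,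
    fun a ha => hM ha⟩
  · refine (Ultrafilter.eventually_or.1 (Filter.Eventually.of_forall fun i => ?_) :
      (∀ᶠ i in (U : Filter ι), 1 ≤ f i (C.toLGroupOf a)) ∨
        ∀ᶠ i in (U : Filter ι), 1 ≤ f i (C.toLGroupOf a⁻¹))
    rw [map_inv, map_inv, one_le_inv']
    exact le_total _ _
  · refine Filter.Eventually.of_forall fun i => ?_
    have h := (hf i).monotone (C.monotone_toLGroupOf ha)
    simpa using h
  · change ∀ᶠ i in (U : Filter ι), 1 ≤ f i (C.toLGroupOf (g * a * g⁻¹))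
    have ha' : ∀ᶠ i in (U : Filter ι), 1 ≤ f i (C.toLGroupOf a) := ha
    filter_upwards [ha'] with i h
    simpa using mul_le_mul_left (mul_le_mul_right h (f i (C.toLGroupOf g)))
      (f i (C.toLGroupOf g))⁻¹

end PreCone

/-! ### Separation of the elements of an ℓ-group by total submonoids -/

section Separation

variable {H : Type u} [Group H] [Lattice H] [MulLeftMono H] [MulRightMono H]

/-- Expand the power: every word except `b ^ k` has a factor `a`, and the remaining factors are at
most `1`, so it lies below `a`. -/
theorem sup_pow_le {a b : H} (ha : a ≤ 1) (hb : b ≤ 1) (k : ℕ) : (a ⊔ b) ^ k ≤ a ⊔ b ^ k := by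
  induction k with
  | zero => simp
  | succ k ih =>
    calc (a ⊔ b) ^ (k + 1) = (a ⊔ b) ^ k * (a ⊔ b) := pow_succ _ _
      _ ≤ (a ⊔ b ^ k) * (a ⊔ b) := mul_le_mul_left ih _
      _ = (a * a ⊔ b ^ k * a) ⊔ (a * b ⊔ b ^ k * b) := by rw [mul_sup, sup_mul, sup_mul]
      _ ≤ a ⊔ b ^ (k + 1) := by
        rw [pow_succ]
        refine sup_le (sup_le ?_ ?_) (sup_le ?_ le_sup_right)
        · exact (mul_le_of_le_one_right' ha).trans le_sup_left
        · exact (mul_le_of_le_one_left' (pow_le_one' hb k)).trans le_sup_left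
        · exact (mul_le_of_le_one_right' hb).trans le_sup_left

/-- A submonoid of an ℓ-group that contains the positive cone and is closed under `h ↦ h ⊓ 1`. -/
structure IsConeFilter (M : Submonoid H) : Prop where
  pos_mem : ∀ a, 1 ≤ a → a ∈ M
  inf_one_mem : ∀ a ∈ M, a ⊓ 1 ∈ M

theorem IsConeFilter.mem_of_le {M : Submonoid H} (hM : IsConeFilter M) {a b : H} (ha : a ∈ M)
    (h : a ≤ b) : b ∈ M := by
  have h₁ : b * a⁻¹ ∈ M := hM.pos_mem _ (by simpa using h)
  simpa using M.mul_mem h₁ ha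

/-- The extension of `M` by an element `u ≤ 1`. -/
def coneAdjoin (M : Submonoid H) (u : H) (_ : u ≤ 1) : Submonoid H where
  carrier := {h | ∃ n ∈ M, n ≤ 1 ∧ ∃ k : ℕ, (n * u) ^ k ≤ h}
  one_mem' := ⟨1, M.one_mem, le_rfl, 0, by simp⟩
  mul_mem' := by
    rintro a b ⟨n, hn, hn₁, k, hk⟩ ⟨m, hm, hm₁, l, hl⟩
    -- The bounds `n ≤ 1` and `m ≤ 1` put `n * m` below both, so it serves as a common multiplier.
    refine ⟨n * m, M.mul_mem hn hm, mul_le_one' hn₁ hm₁, k + l, ?_⟩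
    rw [pow_add]
    refine (mul_le_mul' (pow_le_pow_left' ?_ k) (pow_le_pow_left' ?_ l)).trans (mul_le_mul' hk hl)
    · exact mul_le_mul_left (mul_le_of_le_one_right' hm₁) u
    · exact mul_le_mul_left (mul_le_of_le_one_left' hn₁) u

theorem isConeFilter_coneAdjoin {M : Submonoid H} {u : H} (hu : u ≤ 1) :
    IsConeFilter (coneAdjoin M u hu) where
  pos_mem a ha := ⟨1, M.one_mem, le_rfl, 0, by simpa using ha⟩
  inf_one_mem := by
    rintro a ⟨n, hn, hn₁, k, hk⟩
    exact ⟨n, hn, hn₁, k, le_inf hk (pow_le_one' (mul_le_one' hn₁ hu) k)⟩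

theorem mem_coneAdjoin {M : Submonoid H} {u : H} (hu : u ≤ 1) : u ∈ coneAdjoin M u hu :=
  ⟨1, M.one_mem, le_rfl, 1, by simp⟩

theorem IsConeFilter.le_coneAdjoin {M : Submonoid H} (hM : IsConeFilter M) {u : H} (hu : u ≤ 1) :
    M ≤ coneAdjoin M u hu := fun a ha =>
  ⟨a ⊓ 1, hM.inf_one_mem a ha, inf_le_right, 1, by
    rw [pow_one]
    exact (mul_le_of_le_one_right' hu).trans inf_le_left⟩

/-- With the common multiplier `n * m`, the elements `n * m * u` and `n * m * v` have join `n * m`.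
Applying `sup_pow_le` to each exponent in turn bounds `((n * m) ^ k) ^ l` by the join of their
powers, hence by `x`. -/
theorem IsConeFilter.mem_of_mem_coneAdjoin {M : Submonoid H} (hM : IsConeFilter M) {u v x : H}
    (hu : u ≤ 1) (hv : v ≤ 1) (huv : u ⊔ v = 1) (hxu : x ∈ coneAdjoin M u hu)
    (hxv : x ∈ coneAdjoin M v hv) : x ∈ M := by
  obtain ⟨n, hn, hn₁, k, hk⟩ := hxu
  obtain ⟨m, hm, hm₁, l, hl⟩ := hxv
  have hnu : n * m * u ≤ 1 := mul_le_one' (mul_le_one' hn₁ hm₁) hu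
  have hmv : n * m * v ≤ 1 := mul_le_one' (mul_le_one' hn₁ hm₁) hv
  have h₁ : (n * m * u) ^ k ≤ x :=
    (pow_le_pow_left' (mul_le_mul_left (mul_le_of_le_one_right' hm₁) u) k).trans hk
  have h₂ : (n * m * v) ^ l ≤ x :=
    (pow_le_pow_left' (mul_le_mul_left (mul_le_of_le_one_left' hn₁) v) l).trans hl
  have h₃ : ((n * m) ^ k) ^ l ≤ x := by
    have h := sup_pow_le hmv hnu k
    rw [← mul_sup, sup_comm v u, huv, mul_one] at h
    calc ((n * m) ^ k) ^ l ≤ ((n * m * u) ^ k ⊔ n * m * v) ^ l :=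
          pow_le_pow_left' (h.trans_eq (sup_comm _ _)) l
      _ ≤ (n * m * u) ^ k ⊔ (n * m * v) ^ l := sup_pow_le (pow_le_one' hnu k) hmv l
      _ ≤ x := sup_le h₁ h₂
  exact hM.mem_of_le (M.pow_mem (M.pow_mem (M.mul_mem hn hm) k) l) h₃

/-- An element of an ℓ-group that is not positive is missed by some total submonoid that contains
the positive cone. -/
theorem exists_total_submonoid {x : H} (hx : ¬ 1 ≤ x) :
    ∃ M : Submonoid H, (∀ a, a ∈ M ∨ a⁻¹ ∈ M) ∧ (∀ a, 1 ≤ a → a ∈ M) ∧ x ∉ M := by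
  let P : Submonoid H :=
    { carrier := {a | 1 ≤ a}
      one_mem' := le_rfl
      mul_mem' := fun ha hb => one_le_mul ha hb }
  have hP : IsConeFilter P := ⟨fun _ h => h, fun a ha => (le_inf ha le_rfl : 1 ≤ a ⊓ 1)⟩
  -- A cone filter maximal among those missing `x` plays the part of a prime: adjoining any further
  -- negative element captures `x`.
  obtain ⟨M, -, hM⟩ := zorn_le_nonempty₀ {M : Submonoid H | IsConeFilter M ∧ x ∉ M} (by
    intro c hc hchain M₀ hM₀
    have hmem : ∀ {a}, a ∈ sSup c ↔ ∃ M ∈ c, a ∈ M :=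
      Submonoid.mem_sSup_of_directedOn ⟨M₀, hM₀⟩ hchain.directedOn
    refine ⟨sSup c, ⟨⟨fun a ha => ?_, fun a ha => ?_⟩, fun h => ?_⟩, fun M hM => le_sSup hM⟩
    · exact hmem.2 ⟨M₀, hM₀, (hc hM₀).1.pos_mem a ha⟩
    · obtain ⟨M, hM, h⟩ := hmem.1 ha
      exact hmem.2 ⟨M, hM, (hc hM).1.inf_one_mem a h⟩
    · obtain ⟨M, hM, h'⟩ := hmem.1 h
      exact (hc hM).2 h') P ⟨hP, hx⟩
  obtain ⟨hcone, hxM⟩ := hM.prop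
  have key : ∀ u (hu : u ≤ 1), u ∉ M → x ∈ coneAdjoin M u hu := by
    intro u hu huM
    by_contra hxu
    exact huM (hM.le_of_ge ⟨isConeFilter_coneAdjoin hu, hxu⟩ (hcone.le_coneAdjoin hu)
      (mem_coneAdjoin hu))
  refine ⟨M, fun y => ?_, hcone.pos_mem, hxM⟩
  by_contra! hy
  -- If `y` and `y⁻¹` are both missing, so are `y ⊓ 1` and `y⁻¹ ⊓ 1`. Their join is `1`, so `x`,
  -- captured by adjoining either, would lie in `M`.
  have hu : y ⊓ 1 ∉ M := fun h => hy.1 (hcone.mem_of_le h inf_le_left)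
  have hv : y⁻¹ ⊓ 1 ∉ M := fun h => hy.2 (hcone.mem_of_le h inf_le_left)
  refine hxM (hcone.mem_of_mem_coneAdjoin inf_le_right inf_le_right ?_ (key _ inf_le_right hu)
    (key _ inf_le_right hv))
  refine le_antisymm (sup_le inf_le_right inf_le_right) ?_
  have h : (y⁻¹ ⊓ 1) = y⁻¹ * (y ⊓ 1) := by rw [mul_inf, inv_mul_cancel, mul_one, inf_comm]
  -- The factors are mutually inverse; distributing the product gives the join of `y⁻¹ ⊓ 1` and `y ⊓
  -- 1`.
  have h₂ : 1 ≤ (y⁻¹ ⊔ 1) * (y ⊓ 1) := by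
    have h₃ : (y⁻¹ ⊔ 1) = (y ⊓ 1)⁻¹ := by rw [inv_inf, inv_one]
    rw [h₃, inv_mul_cancel]
  rw [sup_mul, one_mul, ← h, sup_comm] at h₂
  exact h₂

/-- A positive homomorphism to an ℓ-group that does not send `a` to a positive element yields a
pre-cone that contains the kernel and misses `a`. -/
theorem exists_preCone_not_mem {G : Type u} [Group G] [PartialOrder G] (p : G →* H)
    (hp : Monotone p) {a : G} (ha : ¬ 1 ≤ p a) :
    ∃ C : PreCone G, a ∉ C ∧ ∀ b, p b = 1 → b ∈ C := by
  obtain ⟨M, ht, hpos, hM⟩ := exists_total_submonoid ha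
  refine ⟨PreCone.ofNotMem (M.comap p) (fun b => ?_) (fun b hb => hpos _ ?_) a hM, hM,
    fun b hb => hpos _ hb.ge⟩
  · simpa using ht (p b)
  · simpa using hp hb

end Separation

/-! ### The minimal layer -/

section Layer

variable {V : LGroupClass.{u}} {G : Type u} [Group G] [PartialOrder G]

theorem FreeLGroup.exists_not_one_le {a : G} (h : ¬ 1 ≤ FreeLGroup.eta V G a) :
    ∃ (H : Type u) (_ : Group H) (_ : Lattice H) (_ : MulLeftMono H) (_ : MulRightMono H)
      (_ : V H) (p : G →* H), Monotone p ∧ ¬ 1 ≤ p a := by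
  by_contra! hne
  exact h fun H _ _ _ _ hH p hp => hne H _ _ _ _ hH p hp

/-- The map `η` onto its image. -/
abbrev etaRange (V : LGroupClass.{u}) (G : Type u) [Group G] [PartialOrder G] :
    G →* FreeLGroup.EtaImage V G := (FreeLGroup.eta V G).rangeRestrict

theorem etaRange_monotone : Monotone (etaRange V G) := fun _ _ h => FreeLGroup.eta_monotone h

/-- The preimage under `η` of a pre-cone of `η[G]`. -/
abbrev etaComap (D : PreCone (FreeLGroup.EtaImage V G)) : PreCone G :=
  D.comap (etaRange V G) etaRange_monotone (FreeLGroup.eta V G).rangeRestrict_surjective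

theorem isNormal_etaComap {D : PreCone (FreeLGroup.EtaImage V G)} :
    (etaComap D).IsNormal ↔ D.IsNormal := by
  have hconj : ∀ a g : G, etaRange V G (g * a * g⁻¹) =
      etaRange V G g * etaRange V G a * (etaRange V G g)⁻¹ := fun a g => by
    rw [map_mul, map_mul, map_inv]
  constructor
  · rintro h ⟨_, a, rfl⟩ ha ⟨_, g, rfl⟩
    have h' := h a ha g
    rwa [PreCone.mem_comap, hconj] at h'
  · intro h a ha g
    rw [PreCone.mem_comap, hconj]
    exact h _ ha (etaRange V G g)

theorem hasCommutators_etaComap (D : PreCone (FreeLGroup.EtaImage AbelianLGroups G)) :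
    (etaComap D).HasCommutators := by
  intro a b
  rw [PreCone.mem_comap]
  have h : etaRange AbelianLGroups G (a * b * a⁻¹ * b⁻¹) = 1 := by
    refine Subtype.ext ?_
    change FreeLGroup.eta AbelianLGroups G (a * b * a⁻¹ * b⁻¹) = 1
    rw [map_mul, map_mul, map_mul, FreeLGroup.mem_abelian (FreeLGroup.eta _ G a), map_inv, map_inv,
      mul_inv_cancel_right, mul_inv_cancel]
  rw [h]
  exact D.one_mem

variable [MulLeftMono G] [MulRightMono G]

/-- The order of the free ℓ-group tests all positive homomorphisms into `V`, and `G → H_C` is one of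
them; evaluate at `[1]`. -/
theorem PreCone.mem_of_one_le_eta {C : PreCone G} (hC : C ∈ VPreCones G V) {a : G}
    (ha : 1 ≤ FreeLGroup.eta V G a) : a ∈ C := by
  have h : 1 ≤ C.toLGroupOf a := ha C.LGroupOf hC C.toLGroupOf C.monotone_toLGroupOf
  have h' : C.rho 1 ≤ C.rho a := by rw [map_one]; exact h
  simpa using (C.rho_le_rho 1 a).1 h' 1

/-- A pre-cone in `VPreCones G V` is the preimage of a pre-cone of `η[G]`. -/
theorem PreCone.exists_etaComap_eq {C : PreCone G} (hC : C ∈ VPreCones G V) :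
    ∃ D : PreCone (FreeLGroup.EtaImage V G), etaComap D = C := by
  let M : Submonoid (FreeLGroup.EtaImage V G) := C.toSubmonoid.map (etaRange V G)
  have hM : ∀ {a : G}, etaRange V G a ∈ M ↔ a ∈ C := by
    refine fun {a} => ⟨?_, fun h => ⟨a, h, rfl⟩⟩
    rintro ⟨b, hb, hab⟩
    -- Elements with the same image under `η` differ by a kernel element, which lies in `C`; so `C`
    -- is saturated.
    have h : a * b⁻¹ ∈ C := by
      refine PreCone.mem_of_one_le_eta hC ?_
      have hab' : FreeLGroup.eta V G b = FreeLGroup.eta V G a := congrArg Subtype.val hab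
      rw [map_mul, map_inv, hab', mul_inv_cancel]
    simpa using C.mul_mem h hb
  obtain ⟨x, hx⟩ := C.exists_not_mem
  refine ⟨ofNotMem M ?_ ?_ (etaRange V G x) (fun h => hx (hM.1 h)), SetLike.ext fun a => hM⟩
  · rintro ⟨_, a, rfl⟩
    change etaRange V G a ∈ M ∨ (etaRange V G a)⁻¹ ∈ M
    rw [← map_inv, hM, hM]
    exact C.total' a
  · rintro ⟨_, a, rfl⟩ ha
    exact hM.2 (PreCone.mem_of_one_le_eta hC ha)

/-- The minimal layer is homeomorphic to the space of those right orders on `η[G]` whose preimages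
belong to a class `P` of right pre-orders that is closed under lexicographic refinement, coinitial
in `VPreCones G V`, and large enough to separate the elements of `G`. -/
theorem nonempty_minimalLayer_homeomorph (P : PreCone G → Prop)
    (hPV : ∀ C, P C → C ∈ VPreCones G V)
    (hVP : ∀ C ∈ VPreCones G V, ∃ D, P D ∧ D ≤ C)
    (hlex : ∀ C D, P C → P D → P (C.lex D))
    (hsep : ∀ (H : Type u) [Group H] [Lattice H] [MulLeftMono H] [MulRightMono H], V H →
      ∀ p : G →* H, Monotone p → ∀ a, ¬ 1 ≤ p a → ∃ C, P C ∧ a ∉ C)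
    (S : Set (PreCone (FreeLGroup.EtaImage V G)))
    (hS : ∀ D, D ∈ S ↔ D.IsRightOrder ∧ P (etaComap D)) :
    Nonempty (MinimalLayer G V ≃ₜ S) := by
  have himage : etaComap '' S = MinimalLayer G V := by
    refine Set.Subset.antisymm ?_ fun C hC => ?_
    · rintro _ ⟨D, hD, rfl⟩
      obtain ⟨hD₁, hD₂⟩ := (hS D).1 hD
      refine ⟨hPV _ hD₂, fun C hC hCD a ha => ?_⟩
      by_contra haC
      have h₁ : (etaRange V G a)⁻¹ ∈ D := by
        rw [← map_inv]
        exact hCD (C.inv_mem_of_not_mem haC)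
      have h₂ : FreeLGroup.eta V G a = 1 := congrArg Subtype.val (hD₁ _ ha h₁)
      exact haC (PreCone.mem_of_one_le_eta hC h₂.ge)
    · have hPC : P C := by
        obtain ⟨D, hD, hDC⟩ := hVP C hC.prop
        rwa [le_antisymm (hC.le_of_le (hPV D hD) hDC) hDC]
      have key : ∀ a, a ∈ C → a⁻¹ ∈ C → 1 ≤ FreeLGroup.eta V G a := by
        intro a ha ha'
        by_contra hne
        obtain ⟨H, _, _, _, _, hH, p, hp, hpa⟩ := FreeLGroup.exists_not_one_le hne
        obtain ⟨D, hD, haD⟩ := hsep H hH p hp a hpa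
        -- By minimality `C` is contained in `C.lex D`, so `a`, having its inverse in `C`, must lie
        -- in `D`.
        exact haD ((hC.le_of_le (hPV _ (hlex C D hPC hD)) (C.lex_le D) ha).2 ha')
      obtain ⟨D, rfl⟩ := PreCone.exists_etaComap_eq hC.prop
      refine ⟨D, (hS D).2 ⟨?_, hPC⟩, rfl⟩
      rintro ⟨_, a, rfl⟩ ha ha'
      replace ha' : etaRange V G a⁻¹ ∈ D := by rwa [map_inv]
      have h₁ := key a ha ha'
      have h₂ := key a⁻¹ ha' (by rw [inv_inv]; exact ha)
      rw [map_inv, one_le_inv'] at h₂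
      exact Subtype.ext (le_antisymm h₂ h₁)
  exact ⟨(((PreCone.isEmbedding_comap _ _ _).homeomorphImage S).trans
    (Homeomorph.setCongr himage)).symm⟩

end Layer

end RightPreorders

/-! ### The three varieties -/

theorem theorem5p10 (G : Type u) [Group G] [PartialOrder G] [MulLeftMono G] [MulRightMono G] :
    Nonempty (MinimalLayer G AllLGroups ≃ₜ
      RightOrders (FreeLGroup.EtaImage AllLGroups G)) ∧
    Nonempty (MinimalLayer G RepresentableLGroups ≃ₜ
      BiOrders (FreeLGroup.EtaImage RepresentableLGroups G)) ∧
    Nonempty (MinimalLayer G AbelianLGroups ≃ₜ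
      BiOrders (FreeLGroup.EtaImage AbelianLGroups G)) := by
  refine ⟨?_, ?_, ?_⟩
  · refine nonempty_minimalLayer_homeomorph (V := AllLGroups) (fun _ => True)
      (fun _ _ => trivial)
      (fun C _ => ⟨C, trivial, le_rfl⟩) (fun _ _ _ _ => trivial) ?_ _
      (fun D => ⟨fun h => ⟨h, trivial⟩, fun h => h.1⟩)
    intro H _ _ _ _ _ p hp a ha
    obtain ⟨C, hC, -⟩ := exists_preCone_not_mem p hp ha
    exact ⟨C, trivial, hC⟩
  · refine nonempty_minimalLayer_homeomorph PreCone.IsNormal (fun _ h => h.mem_representable)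
      (fun _ h => PreCone.exists_isNormal_le h) (fun _ _ hC hD => hC.lex hD) ?_ _
      (fun D => and_congr_right fun _ => isNormal_etaComap.symm)
    intro H _ _ _ _ hH p hp a ha
    obtain ⟨ι, K, _, _, _, _, f, hf, -, hinj⟩ := hH
    obtain ⟨i, hi⟩ : ∃ i, ¬ 1 ≤ f i (p a) := by
      by_contra! h
      exact ha (one_le_of_forall_isLHom hf hinj h)
    -- The positive cone of the chain `K i` is total and normal, hence so is its preimage in `G`.
    let M : Submonoid G :=
      { carrier := {b | 1 ≤ f i (p b)}
        one_mem' := by simp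
        mul_mem' := fun {b c} hb hc => by
          change 1 ≤ f i (p (b * c))
          rw [map_mul, map_mul]
          exact one_le_mul hb hc }
    refine ⟨PreCone.ofNotMem M (fun b => ?_) (fun b hb => ?_) a hi, fun b hb g => ?_, hi⟩
    · change 1 ≤ f i (p b) ∨ 1 ≤ f i (p b⁻¹)
      rw [map_inv, map_inv, one_le_inv']
      exact le_total _ _
    · change 1 ≤ f i (p b)
      simpa using (hf i).monotone (hp hb)
    · have hb' : 1 ≤ f i (p b) := hb
      change 1 ≤ f i (p (g * b * g⁻¹))
      simpa using mul_le_mul_left (mul_le_mul_right hb' (f i (p g))) (f i (p g))⁻¹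
  · refine nonempty_minimalLayer_homeomorph PreCone.HasCommutators (fun _ h => h.mem_abelian)
      (fun C h => ⟨C, PreCone.hasCommutators_of_mem_abelian h, le_rfl⟩)
      (fun _ _ hC hD => hC.lex hD) ?_ _
      -- The group `η[G]` is Abelian here, so both normality on `η[G]` and commutators in the
      -- preimage are automatic.
      (fun D => and_congr_right fun _ =>
        ⟨fun _ => hasCommutators_etaComap D, fun h => isNormal_etaComap.1 h.isNormal⟩)
    intro H _ _ _ _ hH p hp a ha
    obtain ⟨C, hC, hker⟩ := exists_preCone_not_mem p hp ha
    -- Commutators lie in the kernel of `p` because `H` is Abelian.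
    refine ⟨C, fun b c => hker _ ?_, hC⟩
    rw [map_mul, map_mul, map_mul, hH (p b), map_inv, map_inv, mul_inv_cancel_right,
      mul_inv_cancel]
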